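/- An MV-algebra $(A,\oplus,\neg,0)$ is an MV-chain if $1\neq 0$ (where $1=\neg 0$) and for all $x,y$ either $x\ominus y=0$ or $y\ominus x=0$, where $x\ominus y=\neg(\neg x\oplus y)$; it is simple if $1\ne 0$ and $\{0\}$ is its only proper ideal. An mv-space $(X,\mathsf E)$ is a topological space $X$ with a sheaf of MV-chains on it, i.e. a local homeomorphism $\pi:E\to X$ whose fibers $E_x$ are MV-chains with continuous fiberwise operations. A morphism $(f,\varphi):(X,\mathsf E)\to(Y,\mathsf F)$ of mv-spaces is a continuous map $f:X\to Y$ with MV-algebra morphisms $\varphi_x:F_{f(x)}\to E_x$, $x\in X$, such that for every open $V\subseteq Y$ and every section $s\in\Gamma(V,F)$ the map $x\mapsto\varphi_x(s(f(x)))$ is a section of $E$ over $f^{-1}(V)$. For an MV-algebra $A$, let $\mathrm{Spec}\,A=(Z_A,E_A)$ be the mv-space where $Z_A$ is the set of prime ideals of $A$ with the topology whose base consists of the sets $W_a=\{P\mid a\in P\}$, $a\in A$, and $E_A=\coprod_{P\in Z_A}A/P$, with the topology whose base consists of the sets $\{([a]_P,P)\mid P\in W_b\}$, $a,b\in A$.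 For an mv-space $(X,\mathsf E)$ let $\Gamma(X,E)$ be the MV-algebra of its global sections, and let $$(h,\varepsilon):(X,\mathsf E)\to\mathrm{Spec}\,\Gamma(X,E),\qquad h(x)=\{\sigma\mid\sigma(x)=0\},\qquad \varepsilon_x:\Gamma(X,E)/h(x)\to E_x,\quad \varepsilon_x([\sigma]_{h(x)})=\sigma(x).$$ **Theorem.** Let $(X,\mathsf E)$ be an mv-space such that $X$ is a Stone space (compact Hausdorff with a base of clopen sets), the total space $E$ is Hausdorff, every fiber $E_x$ is a simple MV-algebra, and $\mathsf E$ is global (every point of $E$ is a value of some global section). Then $(h,\varepsilon)$ is an isomorphism of mv-spaces. -/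

import Mathlib

open CategoryTheory TopologicalSpace

universe u

/-- An MV-algebra: `x + y` is `x ⊕ y`, `xᶜ` is `¬ x`, and `0` is the constant `0`. -/
class MVAlgebra (A : Type u) extends AddCommMonoid A, Compl A where
  mv_neg_neg (x : A) : xᶜᶜ = x
  mv_add_neg_zero (x : A) : x + (0 : A)ᶜ = (0 : A)ᶜ
  lukasiewicz (x y : A) : (xᶜ + y)ᶜ + y = (yᶜ + x)ᶜ + x

namespace MVAlgebra

variable {A : Type u} [MVAlgebra A]

/-- `1 = ¬ 0`. -/
instance : One A := ⟨(0 : A)ᶜ⟩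

/-- `x ⊙ y = ¬ (¬ x ⊕ ¬ y)`. -/
def odot (x y : A) : A := (xᶜ + yᶜ)ᶜ

/-- `x ⊖ y = x ⊙ ¬ y`. -/
def ominus (x y : A) : A := odot x yᶜ

/-- The distance `d(x, y) = (x ⊖ y) ⊕ (y ⊖ x)`. -/
def mvDist (x y : A) : A := ominus x y + ominus y x

/-- `x ≤ y` iff `x ⊕ z = y` for some `z`. -/
instance : LE A := ⟨fun x y => ∃ z, x + z = y⟩

theorem mv_le_def (x y : A) : x ≤ y ↔ ∃ z, x + z = y := Iff.rfl

theorem mv_one_def : (1 : A) = (0 : A)ᶜ := rfl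

theorem mv_neg_one : (1 : A)ᶜ = 0 := mv_neg_neg 0

theorem mv_add_one (x : A) : x + 1 = 1 := mv_add_neg_zero x

theorem mv_one_add (x : A) : 1 + x = 1 := by rw [add_comm, mv_add_one]

theorem mv_neg_add_self (x : A) : xᶜ + x = 1 := by
  have h := lukasiewicz x 1
  rw [mv_add_one, mv_neg_one, zero_add] at h
  exact h.symm

theorem ominus_eq (x y : A) : ominus x y = (xᶜ + y)ᶜ := by
  simp only [ominus, odot, mv_neg_neg]

theorem ominus_add_comm (x y : A) : ominus x y + y = ominus y x + x := by
  rw [ominus_eq, ominus_eq, lukasiewicz]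

theorem le_iff_ominus (x y : A) : x ≤ y ↔ ominus x y = 0 := by
  constructor
  · rintro ⟨z, rfl⟩
    rw [ominus_eq, ← add_assoc, mv_neg_add_self, mv_one_add, mv_neg_one]
  · intro h
    refine ⟨ominus y x, ?_⟩
    rw [add_comm, ominus_add_comm, h, zero_add]

theorem le_iff_neg_add (x y : A) : x ≤ y ↔ xᶜ + y = 1 := by
  rw [le_iff_ominus, ominus_eq]
  constructor
  · intro h
    rw [← mv_neg_neg (xᶜ + y), h, mv_one_def]
  · intro h
    rw [h, mv_neg_one]

theorem mv_le_trans {x y z : A} (h : x ≤ y) (h' : y ≤ z) : x ≤ z := by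
  obtain ⟨a, rfl⟩ := h
  obtain ⟨b, rfl⟩ := h'
  exact ⟨a + b, (add_assoc _ _ _).symm⟩

theorem le_add_left' (x y : A) : x ≤ x + y := ⟨y, rfl⟩

theorem le_add_right' (x y : A) : y ≤ x + y := ⟨x, add_comm _ _⟩

theorem mv_add_le_add {x y u v : A} (h : x ≤ y) (h' : u ≤ v) : x + u ≤ y + v := by
  obtain ⟨a, rfl⟩ := h
  obtain ⟨b, rfl⟩ := h'
  exact ⟨a + b, add_add_add_comm _ _ _ _⟩

theorem ominus_le_iff (x y z : A) : ominus x y ≤ z ↔ x ≤ y + z := by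
  rw [le_iff_neg_add, le_iff_neg_add, ominus_eq, mv_neg_neg, add_assoc]

theorem le_add_ominus (x y : A) : x ≤ y + ominus x y :=
  (ominus_le_iff _ _ _).1 ⟨0, add_zero _⟩

theorem ominus_triangle (x y z : A) : ominus x z ≤ ominus x y + ominus y z := by
  rw [ominus_le_iff]
  refine mv_le_trans (le_add_ominus x y) ?_
  refine mv_le_trans (mv_add_le_add (le_add_ominus y z) ⟨0, add_zero _⟩) ⟨0, ?_⟩
  rw [add_zero, add_assoc, add_comm (ominus y z)]

theorem ominus_add_add (x u y v : A) :
    ominus (x + u) (y + v) ≤ ominus x y + ominus u v := by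
  rw [ominus_le_iff]
  refine mv_le_trans (mv_add_le_add (le_add_ominus x y) (le_add_ominus u v)) ⟨0, ?_⟩
  rw [add_zero, add_add_add_comm]

theorem ominus_neg_neg (x y : A) : ominus xᶜ yᶜ = ominus y x := by
  rw [ominus_eq, ominus_eq, mv_neg_neg, add_comm]

theorem ominus_self (x : A) : ominus x x = 0 := (le_iff_ominus x x).1 ⟨0, add_zero _⟩

theorem ominus_zero (x : A) : ominus x 0 = x := by rw [ominus_eq, add_zero, mv_neg_neg]

theorem eq_of_ominus {x y : A} (h : ominus x y = 0) (h' : ominus y x = 0) : x = y := by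
  have := ominus_add_comm x y
  rw [h, h', zero_add, zero_add] at this
  exact this.symm

variable (A) in
/-- An MV-chain: a nontrivial MV-algebra in which any two elements are comparable. -/
def IsMVChain : Prop :=
  (1 : A) ≠ 0 ∧ ∀ x y : A, ominus x y = 0 ∨ ominus y x = 0

end MVAlgebra

open MVAlgebra

/-- Morphisms of MV-algebras: maps preserving `⊕`, `¬` and `0`. -/
structure MVHom (A B : Type u) [MVAlgebra A] [MVAlgebra B] extends A →+ B where
  map_neg' (x : A) : toFun xᶜ = (toFun x)ᶜ

namespace MVHom

instance {A B : Type u} [MVAlgebra A] [MVAlgebra B] : CoeFun (MVHom A B) fun _ => A → B :=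
  ⟨fun φ => φ.toFun⟩

/-- The identity morphism. -/
def id (A : Type u) [MVAlgebra A] : MVHom A A where
  toAddMonoidHom := AddMonoidHom.id A
  map_neg' _ := rfl

/-- Composition of morphisms (first `φ`, then `ψ`). -/
def comp {A B C : Type u} [MVAlgebra A] [MVAlgebra B] [MVAlgebra C]
    (ψ : MVHom B C) (φ : MVHom A B) : MVHom A C where
  toFun x := ψ (φ x)
  map_zero' := by
    change ψ.toAddMonoidHom (φ.toAddMonoidHom 0) = 0
    simp
  map_add' x y := by
    change ψ.toAddMonoidHom (φ.toAddMonoidHom (x + y)) =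
      ψ.toAddMonoidHom (φ.toAddMonoidHom x) + ψ.toAddMonoidHom (φ.toAddMonoidHom y)
    simp
  map_neg' x := by
    rw [φ.map_neg', ψ.map_neg']

end MVHom

/-- Ideals of an MV-algebra: they contain `0`, are downward closed, and are closed under `⊕`. -/
structure MVIdeal (A : Type u) [MVAlgebra A] where
  carrier : Set A
  zero_mem' : (0 : A) ∈ carrier
  down_mem' : ∀ {x y : A}, x ∈ carrier → y ≤ x → y ∈ carrier
  add_mem' : ∀ {x y : A}, x ∈ carrier → y ∈ carrier → x + y ∈ carrier

namespace MVIdeal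

variable {A : Type u} [MVAlgebra A]

instance : Membership A (MVIdeal A) := ⟨fun I x => x ∈ I.carrier⟩

/-- Prime ideals: `1 ∉ P`, and `x ⊖ y ∈ P` or `y ⊖ x ∈ P` for all `x`, `y`. -/
def IsPrime (P : MVIdeal A) : Prop :=
  (1 : A) ∉ P ∧ ∀ x y : A, ominus x y ∈ P ∨ ominus y x ∈ P

theorem dist_mem_iff (I : MVIdeal A) (x y : A) :
    mvDist x y ∈ I ↔ ominus x y ∈ I ∧ ominus y x ∈ I :=
  ⟨fun h => ⟨I.down_mem' h (le_add_left' _ _), I.down_mem' h (le_add_right' _ _)⟩,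
    fun h => I.add_mem' h.1 h.2⟩

/-- The congruence of an ideal: `x ∼ y` iff `d(x, y) ∈ I`. -/
def setoid (I : MVIdeal A) : Setoid A where
  r x y := mvDist x y ∈ I
  iseqv :=
    { refl := fun x => by
        rw [dist_mem_iff, ominus_self]
        exact ⟨I.zero_mem', I.zero_mem'⟩
      symm := fun {x y} h => by
        rw [dist_mem_iff] at h ⊢
        exact h.symm
      trans := fun {x y z} h h' => by
        rw [dist_mem_iff] at h h' ⊢
        exact ⟨I.down_mem' (I.add_mem' h.1 h'.1) (ominus_triangle _ _ _),
          I.down_mem' (I.add_mem' h'.2 h.2) (ominus_triangle _ _ _)⟩ }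

/-- The quotient `A / I`. -/
def Quot (I : MVIdeal A) : Type u := Quotient I.setoid

/-- The class `[x]_I` of `x` in `A / I`. -/
def cls (I : MVIdeal A) (x : A) : I.Quot := Quotient.mk I.setoid x

theorem cls_surjective (I : MVIdeal A) (q : I.Quot) : ∃ x, I.cls x = q :=
  Quotient.exists_rep q

theorem cls_eq_iff (I : MVIdeal A) (x y : A) : I.cls x = I.cls y ↔ mvDist x y ∈ I :=
  Quotient.eq (r := I.setoid)

theorem cls_eq_zero_iff (I : MVIdeal A) (x : A) : I.cls x = I.cls 0 ↔ x ∈ I := by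
  rw [cls_eq_iff, dist_mem_iff, ominus_zero]
  refine ⟨fun h => h.1, fun h => ⟨h, I.down_mem' h ?_⟩⟩
  rw [ominus_le_iff]
  exact ⟨x + x, zero_add _⟩

instance (I : MVIdeal A) : Zero I.Quot := ⟨I.cls 0⟩

instance (I : MVIdeal A) : Add I.Quot :=
  ⟨Quotient.map₂ (· + ·) fun x y h u v h' => by
    change mvDist _ _ ∈ I
    replace h := (I.dist_mem_iff _ _).1 h
    replace h' := (I.dist_mem_iff _ _).1 h'
    rw [dist_mem_iff]
    exact ⟨I.down_mem' (I.add_mem' h.1 h'.1) (ominus_add_add _ _ _ _),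
      I.down_mem' (I.add_mem' h.2 h'.2) (ominus_add_add _ _ _ _)⟩⟩

instance (I : MVIdeal A) : Compl I.Quot :=
  ⟨Quotient.map (·ᶜ) fun x y h => by
    change mvDist _ _ ∈ I
    replace h := (I.dist_mem_iff _ _).1 h
    rw [dist_mem_iff, ominus_neg_neg, ominus_neg_neg]
    exact h.symm⟩

theorem cls_zero (I : MVIdeal A) : I.cls 0 = 0 := rfl

theorem cls_add (I : MVIdeal A) (x y : A) : I.cls (x + y) = I.cls x + I.cls y := rfl

theorem cls_neg (I : MVIdeal A) (x : A) : I.cls xᶜ = (I.cls x)ᶜ := rfl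

/-- The quotient MV-algebra `A / I`, with operations computed on representatives. -/
instance (I : MVIdeal A) : MVAlgebra I.Quot where
  add_assoc := by
    rintro ⟨x⟩ ⟨y⟩ ⟨z⟩
    exact congrArg I.cls (add_assoc x y z)
  zero_add := by
    rintro ⟨x⟩
    exact congrArg I.cls (zero_add x)
  add_zero := by
    rintro ⟨x⟩
    exact congrArg I.cls (add_zero x)
  add_comm := by
    rintro ⟨x⟩ ⟨y⟩
    exact congrArg I.cls (add_comm x y)
  nsmul := nsmulRec
  mv_neg_neg := by
    rintro ⟨x⟩
    exact congrArg I.cls (MVAlgebra.mv_neg_neg x)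
  mv_add_neg_zero := by
    rintro ⟨x⟩
    exact congrArg I.cls (MVAlgebra.mv_add_neg_zero x)
  lukasiewicz := by
    rintro ⟨x⟩ ⟨y⟩
    exact congrArg I.cls (MVAlgebra.lukasiewicz x y)

theorem isMVChain_quot {P : MVIdeal A} (hP : P.IsPrime) : IsMVChain P.Quot := by
  refine ⟨fun h => hP.1 ((P.cls_eq_zero_iff 1).1 h), ?_⟩
  rintro ⟨x⟩ ⟨y⟩
  exact (hP.2 x y).imp (fun h => (P.cls_eq_zero_iff _).2 h) (fun h => (P.cls_eq_zero_iff _).2 h)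

end MVIdeal

/-- Simple MV-algebras: nontrivial, and `{0}` is the only proper ideal. -/
def MVAlgebra.IsSimpleMV (A : Type u) [MVAlgebra A] : Prop :=
  (1 : A) ≠ 0 ∧ ∀ I : MVIdeal A, (1 : A) ∉ I → I.carrier = {0}

/-- Stone spaces: compact Hausdorff spaces with a base of clopen sets. -/
structure IsStoneSpace (X : Type u) [TopologicalSpace X] : Prop where
  compact : CompactSpace X
  hausdorff : T2Space X
  clopen_basis : IsTopologicalBasis {U : Set X | IsClopen U}

/-- The disjoint union of a family of sets indexed by `X`: the underlying set of an etale space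
over `X` with the given fibers. -/
structure Etale {X : Type u} (S : X → Type u) where
  base : X
  val : S base

/-- The fiber product over `X` of the etale space with itself, with the topology of a subspace of
the product. -/
structure EtalePairs {X : Type u} (S : X → Type u) where
  base : X
  left : S base
  right : S base

namespace EtalePairs

variable {X : Type u} {S : X → Type u}

/-- First projection. -/
def fst (q : EtalePairs S) : Etale S := ⟨q.base, q.left⟩

/-- Second projection. -/
def snd (q : EtalePairs S) : Etale S := ⟨q.base, q.right⟩

instance [TopologicalSpace (Etale S)] : TopologicalSpace (EtalePairs S) :=
  TopologicalSpace.induced (fun q => (q.fst, q.snd)) inferInstance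

end EtalePairs

/-- An MV-space: a topological space `X` with a sheaf of MV-chains on it, that is, an etale space
(presented as the disjoint union of its fibers) whose fibers are MV-chains and whose fiberwise
operations are continuous. -/
structure MVSpace where
  carrier : Type u
  [topBase : TopologicalSpace carrier]
  stalk : carrier → Type u
  [mvStalk : ∀ x, MVAlgebra (stalk x)]
  [topEtale : TopologicalSpace (Etale stalk)]
  isLocalHomeomorph_base : IsLocalHomeomorph (Etale.base : Etale stalk → carrier)
  continuous_zero : Continuous fun x : carrier => (⟨x, 0⟩ : Etale stalk)
  continuous_neg : Continuous fun e : Etale stalk => (⟨e.base, e.valᶜ⟩ : Etale stalk)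
  continuous_add :
    Continuous fun q : EtalePairs stalk => (⟨q.base, q.left + q.right⟩ : Etale stalk)
  isMVChain_stalk : ∀ x, IsMVChain (stalk x)

namespace MVSpace

instance : CoeSort MVSpace.{u} (Type u) := ⟨carrier⟩

attribute [instance] topBase mvStalk topEtale

/-- The total space `E` of the structure sheaf. -/
abbrev total (X : MVSpace.{u}) : Type u := Etale X.stalk

/-- A family `s` of elements of the fibers over an open set `U` is a section over `U` if it is
continuous as a map `U → E`. -/
def IsSection (X : MVSpace.{u}) (U : Opens X) (s : ∀ x : U, X.stalk x) : Prop :=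
  Continuous fun x : U => (⟨x, s x⟩ : X.total)

/-- Morphisms of MV-spaces: a continuous map `f`, with morphisms `φ_x` from the fiber over `f x` to
the fiber over `x`, that carries sections over `V` to sections over `f⁻¹ V`. -/
structure Hom (X Y : MVSpace.{u}) where
  map : C(X, Y)
  stalkMap (x : X) : MVHom (Y.stalk (map x)) (X.stalk x)
  isSection (V : Opens Y) (s : ∀ y : V, Y.stalk y) (hs : Y.IsSection V s) :
    X.IsSection (V.comap map) fun x => stalkMap x (s ⟨map x, x.2⟩)

/-- The category of MV-spaces. -/
instance : Category MVSpace.{u} where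
  Hom := Hom
  id X :=
    { map := ContinuousMap.id X
      stalkMap := fun x => MVHom.id (X.stalk x)
      isSection := fun _ _ hs => hs }
  comp {X Y Z} F G :=
    { map := G.map.comp F.map
      stalkMap := fun x => (F.stalkMap x).comp (G.stalkMap (F.map x))
      isSection := fun V s hs => F.isSection _ _ (G.isSection V s hs) }

/-- The set `Γ(X, E)` of global sections. -/
def GlobalSections (X : MVSpace.{u}) : Type u :=
  {s : ∀ x : X, X.stalk x // Continuous fun x => (⟨x, s x⟩ : X.total)}

namespace GlobalSections

variable {X : MVSpace.{u}}

instance : Zero X.GlobalSections := ⟨⟨fun _ => 0, X.continuous_zero⟩⟩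

instance : Add X.GlobalSections :=
  ⟨fun s t => ⟨fun x => s.1 x + t.1 x, by
    have h : Continuous fun x : X => (⟨x, s.1 x, t.1 x⟩ : EtalePairs X.stalk) :=
      continuous_induced_rng.2 (s.2.prodMk t.2)
    exact X.continuous_add.comp h⟩⟩

instance : Compl X.GlobalSections :=
  ⟨fun s => ⟨fun x => (s.1 x)ᶜ, X.continuous_neg.comp s.2⟩⟩

/-- The MV-algebra `Γ(X, E)`, with pointwise operations. -/
instance : MVAlgebra X.GlobalSections where
  add_assoc s t r := Subtype.ext (funext fun _ => add_assoc _ _ _)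
  zero_add s := Subtype.ext (funext fun _ => zero_add _)
  add_zero s := Subtype.ext (funext fun _ => add_zero _)
  add_comm s t := Subtype.ext (funext fun _ => add_comm _ _)
  nsmul := nsmulRec
  mv_neg_neg s := Subtype.ext (funext fun _ => MVAlgebra.mv_neg_neg _)
  mv_add_neg_zero s := Subtype.ext (funext fun _ => MVAlgebra.mv_add_neg_zero _)
  lukasiewicz s t := Subtype.ext (funext fun _ => MVAlgebra.lukasiewicz _ _)

end GlobalSections

/-- The sheaf is global: every point of `E` is a value of some global section. -/
def IsGlobal (X : MVSpace.{u}) : Prop :=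
  ∀ e : X.total, ∃ s : X.GlobalSections, (⟨e.base, s.1 e.base⟩ : X.total) = e

end MVSpace

/-- The set `Z_A` of prime ideals of `A`. -/
def PrimeSpec (A : Type u) [MVAlgebra A] : Type u := {P : MVIdeal A // P.IsPrime}

namespace PrimeSpec

variable {A : Type u} [MVAlgebra A]

/-- The set `W_a` of prime ideals containing `a`. -/
def W (a : A) : Set (PrimeSpec A) := {P | a ∈ P.1}

/-- The coZariski topology on `Z_A`, generated by the sets `W_a`. -/
instance : TopologicalSpace (PrimeSpec A) := generateFrom (Set.range W)

theorem isOpen_W (a : A) : IsOpen (W a) := isOpen_generateFrom_of_mem ⟨a, rfl⟩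

/-- The sets `W_a` form a base of the topology. -/
theorem isTopologicalBasis_W : IsTopologicalBasis (Set.range (W : A → Set (PrimeSpec A))) where
  exists_subset_inter := by
    rintro _ ⟨a, rfl⟩ _ ⟨b, rfl⟩ P hP
    refine ⟨W (a + b), ⟨_, rfl⟩, P.1.add_mem' hP.1 hP.2, fun Q hQ => ⟨?_, ?_⟩⟩
    · exact Q.1.down_mem' hQ (le_add_left' _ _)
    · exact Q.1.down_mem' hQ (le_add_right' _ _)
  sUnion_eq := Set.eq_univ_of_forall fun P => ⟨W 0, ⟨0, rfl⟩, P.1.zero_mem'⟩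
  eq_generateFrom := rfl

/-- The fiber `A / P` over `P`. -/
abbrev fiber (P : PrimeSpec A) : Type u := P.1.Quot

/-- The section `â : Z_A → E_A`, `â(P) = [a]_P`. -/
def hat (a : A) (P : PrimeSpec A) : Etale (fiber (A := A)) := ⟨P, P.1.cls a⟩

/-- The topology on `E_A` generated by the sets `â(W_b)`. -/
instance : TopologicalSpace (Etale (fiber (A := A))) :=
  generateFrom (Set.range fun p : A × A => hat p.1 '' W p.2)

theorem isOpen_hat_image (a b : A) : IsOpen (hat a '' W b) :=
  isOpen_generateFrom_of_mem ⟨(a, b), rfl⟩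

theorem hat_eq_iff (a c : A) (P : PrimeSpec A) : hat a P = hat c P ↔ mvDist a c ∈ P.1 := by
  rw [← MVIdeal.cls_eq_iff]
  simp [hat]

theorem exists_hat (e : Etale (fiber (A := A))) : ∃ a, hat a e.base = e := by
  obtain ⟨P, q⟩ := e
  obtain ⟨a, rfl⟩ := P.1.cls_surjective q
  exact ⟨a, rfl⟩

theorem continuous_hat (a : A) : Continuous (hat a) := by
  refine continuous_generateFrom_iff.2 ?_
  rintro _ ⟨⟨c, d⟩, rfl⟩
  have : hat a ⁻¹' (hat c '' W d) = W (mvDist a c) ∩ W d := by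
    ext P
    constructor
    · rintro ⟨Q, hQ, h⟩
      obtain rfl : Q = P := congrArg Etale.base h
      exact ⟨(hat_eq_iff a c Q).1 h.symm, hQ⟩
    · rintro ⟨h, hP⟩
      exact ⟨P, hP, ((hat_eq_iff a c P).2 h).symm⟩
  rw [this]
  exact (isOpen_W _).inter (isOpen_W _)

theorem continuous_base : Continuous (Etale.base : Etale (fiber (A := A)) → PrimeSpec A) := by
  refine continuous_generateFrom_iff.2 ?_
  rintro _ ⟨b, rfl⟩
  have : (Etale.base : Etale (fiber (A := A)) → PrimeSpec A) ⁻¹' W b = ⋃ a, hat a '' W b := by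
    ext e
    simp only [Set.mem_iUnion]
    constructor
    · intro he
      obtain ⟨a, ha⟩ := exists_hat e
      exact ⟨a, e.base, he, ha⟩
    · rintro ⟨a, P, hP, rfl⟩
      exact hP
  rw [this]
  exact isOpen_iUnion fun a => isOpen_hat_image a b

theorem isOpen_range_hat (a : A) : IsOpen (Set.range (hat a)) := by
  have h : W (0 : A) = Set.univ := Set.eq_univ_of_forall fun P => P.1.zero_mem'
  rw [← Set.image_univ, ← h]
  exact isOpen_hat_image a 0

theorem eq_hat_of_mem {a : A} {e : Etale (fiber (A := A))} (h : e ∈ Set.range (hat a)) :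
    hat a e.base = e := by
  obtain ⟨P, rfl⟩ := h
  rfl

/-- `E_A → Z_A` is a local homeomorphism, with local inverses the sections `â`. -/
theorem isLocalHomeomorph_base :
    IsLocalHomeomorph (Etale.base : Etale (fiber (A := A)) → PrimeSpec A) := by
  intro e
  obtain ⟨a, ha⟩ := exists_hat e
  refine ⟨
    { toFun := Etale.base
      invFun := hat a
      source := Set.range (hat a)
      target := Set.univ
      map_source' := fun _ _ => trivial
      map_target' := fun P _ => ⟨P, rfl⟩
      left_inv' := fun e he => eq_hat_of_mem he
      right_inv' := fun _ _ => rfl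
      open_source := isOpen_range_hat a
      open_target := isOpen_univ
      continuousOn_toFun := continuous_base.continuousOn
      continuousOn_invFun := (continuous_hat a).continuousOn }, ⟨_, ha⟩, rfl⟩

theorem continuous_neg :
    Continuous fun e : Etale (fiber (A := A)) => (⟨e.base, e.valᶜ⟩ : Etale (fiber (A := A))) := by
  rw [continuous_iff_continuousAt]
  intro e
  obtain ⟨a, ha⟩ := exists_hat e
  refine ((continuous_hat aᶜ).comp continuous_base).continuousAt.congr ?_
  filter_upwards [(isOpen_range_hat a).mem_nhds ⟨_, ha⟩] with e' he'
  obtain ⟨P, rfl⟩ := he'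
  rfl

theorem continuous_add :
    Continuous fun q : EtalePairs (fiber (A := A)) =>
      (⟨q.base, q.left + q.right⟩ : Etale (fiber (A := A))) := by
  rw [continuous_iff_continuousAt]
  intro q
  have hpair : Continuous fun q : EtalePairs (fiber (A := A)) => (q.fst, q.snd) :=
    continuous_induced_dom
  obtain ⟨a, ha⟩ := exists_hat q.fst
  obtain ⟨b, hb⟩ := exists_hat q.snd
  refine ((continuous_hat (a + b)).comp (continuous_base.comp hpair.fst)).continuousAt.congr ?_
  filter_upwards [hpair.fst.continuousAt.preimage_mem_nhds
      ((isOpen_range_hat a).mem_nhds ⟨_, ha⟩),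
    hpair.snd.continuousAt.preimage_mem_nhds ((isOpen_range_hat b).mem_nhds ⟨_, hb⟩)]
    with r hr hr'
  obtain ⟨P, x, y⟩ := r
  have h1 : P.1.cls a = x := by simpa [hat, EtalePairs.fst] using eq_hat_of_mem hr
  have h2 : P.1.cls b = y := by simpa [hat, EtalePairs.snd] using eq_hat_of_mem hr'
  subst h1 h2
  rfl

end PrimeSpec

/-- The prime spectrum `Spec A = (Z_A, E_A)` of an MV-algebra, as an MV-space. -/
def MVSpec (A : Type u) [MVAlgebra A] : MVSpace.{u} where
  carrier := PrimeSpec A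
  stalk := PrimeSpec.fiber
  isLocalHomeomorph_base := PrimeSpec.isLocalHomeomorph_base
  continuous_zero := PrimeSpec.continuous_hat 0
  continuous_neg := PrimeSpec.continuous_neg
  continuous_add := PrimeSpec.continuous_add
  isMVChain_stalk P := MVIdeal.isMVChain_quot P.2

namespace MVSpace

variable (X : MVSpace.{u})

/-- The point `h(x) = {σ | σ(x) = 0}` of the prime spectrum of `Γ(X, E)`. -/
def counitPoint (x : X) : PrimeSpec X.GlobalSections :=
  ⟨{ carrier := {σ | σ.1 x = 0}
     zero_mem' := rfl
     down_mem' := by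
      rintro _ s hs ⟨t, rfl⟩
      have h : s.1 x + t.1 x = 0 := hs
      have h' : ominus (s.1 x) 0 = 0 := (le_iff_ominus _ _).1 ⟨t.1 x, h⟩
      rwa [ominus_zero] at h'
     add_mem' := by
      intro s t hs ht
      have h : s.1 x = 0 := hs
      have h' : t.1 x = 0 := ht
      change s.1 x + t.1 x = 0
      rw [h, h', add_zero] },
    (X.isMVChain_stalk x).1, fun s t => (X.isMVChain_stalk x).2 (s.1 x) (t.1 x)⟩

/-- The morphism `ε_x : Γ(X, E) / h(x) → E_x`, `ε_x([σ]) = σ(x)`. -/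
def counitStalk (x : X) : MVHom (X.counitPoint x).1.Quot (X.stalk x) where
  toFun := Quotient.lift (fun σ => σ.1 x) fun s t h => by
    have h' := ((X.counitPoint x).1.dist_mem_iff s t).1 h
    exact eq_of_ominus h'.1 h'.2
  map_zero' := rfl
  map_add' := by
    rintro ⟨s⟩ ⟨t⟩
    rfl
  map_neg' := by
    rintro ⟨s⟩
    rfl

/-- `{x | σ(x) = τ(x)}` is open for global sections `σ`, `τ`. -/
theorem isOpen_eq_sections (s t : X.GlobalSections) : IsOpen {x : X | s.1 x = t.1 x} := by
  have h := X.isLocalHomeomorph_base.isLocallyInjective.isOpen_eqLocus s.2 t.2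
    (funext fun _ => rfl)
  convert h using 1
  ext x
  simp

theorem continuous_counitPoint : Continuous X.counitPoint := by
  refine continuous_generateFrom_iff.2 ?_
  rintro _ ⟨s, rfl⟩
  exact X.isOpen_eq_sections s 0

/-- The morphism of MV-spaces `(h, ε) : (X, E) → Spec Γ(X, E)`. -/
def counit : X ⟶ MVSpec X.GlobalSections where
  map := ⟨X.counitPoint, X.continuous_counitPoint⟩
  stalkMap := X.counitStalk
  isSection V s hs := by
    refine continuous_iff_continuousAt.2 fun x => ?_
    obtain ⟨σ, hσ⟩ := PrimeSpec.exists_hat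
      (⟨X.counitPoint x, s ⟨X.counitPoint x, x.2⟩⟩ : Etale PrimeSpec.fiber)
    refine (σ.2.comp continuous_subtype_val).continuousAt.congr ?_
    have hc : Continuous fun y : V.comap ⟨X.counitPoint, X.continuous_counitPoint⟩ =>
        (⟨X.counitPoint y, y.2⟩ : V) :=
      (X.continuous_counitPoint.comp continuous_subtype_val).subtype_mk _
    filter_upwards [(Continuous.comp hs hc).continuousAt.preimage_mem_nhds
      ((PrimeSpec.isOpen_range_hat σ).mem_nhds ⟨_, hσ⟩)] with y hy
    have h' : PrimeSpec.hat σ (X.counitPoint y) =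
        ⟨X.counitPoint y, s ⟨X.counitPoint y, y.2⟩⟩ := PrimeSpec.eq_hat_of_mem hy
    have h : (X.counitPoint y).1.cls σ = s ⟨X.counitPoint y, y.2⟩ :=
      eq_of_heq (Etale.mk.inj h').2
    change (⟨y, σ.1 y⟩ : X.total) = ⟨y, X.counitStalk y (s ⟨X.counitPoint y, y.2⟩)⟩
    rw [← h]
    rfl

end MVSpace

/-! A morphism of mv-spaces is invertible once its point map is a homeomorphism and its stalk maps
are bijective, provided the inverse carries sections to sections. Points: if the members of a proper
ideal of `Γ(X, E)` had no common zero, then near each point some member, multiplied enough times,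
would equal `1`, because the fibers are simple; by compactness finitely many of these multiples add
up to the constant `1`. So every prime ideal `P` lies in some `h(x)` (`exists_forall_mem_eq_zero`).
Primality applied to the two-valued sections of clopen sets (`coindicator_mem_or`) gives `h(x) ⊆ P`.
The same sections separate points and show that `h` is open. Stalks: `ε_x` is injective by the
definition of `h(x)` and surjective because the sheaf is global, so lifting a germ value to a global
section inverts it. Near any point a local section coincides with a global one, which settles the
section condition for the inverse. -/

namespace MVAlgebra

/-! ### Order and multiples in simple MV-algebras -/

variable {A : Type u} [MVAlgebra A]

theorem mv_zero_le (x : A) : 0 ≤ x := ⟨x, zero_add x⟩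

theorem mv_le_refl (x : A) : x ≤ x := ⟨0, add_zero x⟩

theorem mv_le_one (x : A) : x ≤ 1 := (le_iff_neg_add x 1).2 (mv_add_one _)

theorem eq_one_of_one_le {x : A} (h : (1 : A) ≤ x) : x = 1 := by
  obtain ⟨z, rfl⟩ := h
  exact mv_one_add z

/-- The ideal generated by an element. -/
def principalIdeal (a : A) : MVIdeal A where
  carrier := {y | ∃ n : ℕ, y ≤ n • a}
  zero_mem' := ⟨0, mv_zero_le _⟩
  down_mem' := fun ⟨n, hn⟩ h => ⟨n, mv_le_trans h hn⟩
  add_mem' := fun ⟨n, hn⟩ ⟨m, hm⟩ => ⟨n + m, by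
    rw [add_nsmul]
    exact mv_add_le_add hn hm⟩

/-- In a simple MV-algebra every nonzero element has a multiple equal to `1`. -/
theorem IsSimpleMV.exists_nsmul_eq_one (hA : IsSimpleMV A) {a : A} (ha : a ≠ 0) :
    ∃ n : ℕ, n • a = 1 := by
  -- If the ideal generated by `a` is improper, then `1 ≤ n • a`; if it is proper, simplicity makes
  -- it `{0}`, although it contains `a`.
  by_cases h1 : (1 : A) ∈ principalIdeal a
  · obtain ⟨n, hn⟩ := h1
    exact ⟨n, eq_one_of_one_le hn⟩
  · have h : a ∈ (principalIdeal a).carrier := ⟨1, by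
      rw [one_nsmul]
      exact mv_le_refl a⟩
    rw [hA.2 _ h1] at h
    exact absurd h ha

end MVAlgebra

/-! ### Equality of morphisms -/

theorem MVHom.ext {A B : Type u} [MVAlgebra A] [MVAlgebra B] {φ ψ : MVHom A B}
    (h : ∀ x, φ x = ψ x) : φ = ψ := by
  obtain ⟨φ, hφ⟩ := φ
  obtain ⟨ψ, hψ⟩ := ψ
  obtain rfl : φ = ψ := AddMonoidHom.ext h
  rfl

namespace MVSpace

/-- Morphisms into `Y` agree if they agree on points and on a family of sections that reaches every
point of the total space. -/
theorem Hom.ext_of_sections {X Y : MVSpace.{u}} {F G : X ⟶ Y} {ι : Type*}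
    (σ : ι → ∀ y : Y, Y.stalk y) (hσ : ∀ (y : Y) (e : Y.stalk y), ∃ i, σ i y = e)
    (hmap : ∀ x, F.map x = G.map x)
    (hstalk : ∀ i x, F.stalkMap x (σ i (F.map x)) = G.stalkMap x (σ i (G.map x))) : F = G := by
  obtain ⟨f, φ, hf⟩ := F
  obtain ⟨g, ψ, hg⟩ := G
  -- The type of a stalk map depends on the point map, so `φ` and `ψ` become comparable only after
  -- this. The hypothesis `hstalk` avoids the issue, since its two sides both lie in the fiber of
  -- `X` over `x`.
  obtain rfl : f = g := ContinuousMap.ext hmap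
  obtain rfl : φ = ψ := by
    funext x
    refine MVHom.ext fun e => ?_
    obtain ⟨i, rfl⟩ := hσ _ e
    exact hstalk i x
  rfl

variable {X : MVSpace.{u}}

/-! ### Ideals of global sections -/

namespace GlobalSections

/-- Evaluation of global sections at a point. -/
def eval (x : X) : X.GlobalSections →+ X.stalk x where
  toFun s := s.1 x
  map_zero' := rfl
  map_add' _ _ := rfl

open Classical in
/-- The global section that is `0` on a clopen set and `1` off it. -/
noncomputable def coindicator {U : Set X} (hU : IsClopen U) : X.GlobalSections :=
  ⟨fun x => if x ∈ U then 0 else 1, by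
    have h : Continuous fun x : X => if x ∈ U then (⟨x, 0⟩ : X.total) else ⟨x, 1⟩ := by
      -- A clopen set has empty frontier, so there is no gluing condition to check.
      refine continuous_if ?_ X.continuous_zero.continuousOn
        (1 : X.GlobalSections).2.continuousOn
      intro x hx
      have hx' : x ∈ frontier U := hx
      rw [hU.frontier_eq] at hx'
      exact hx'.elim
    convert h using 2 with x
    exact apply_ite (Etale.mk x) _ _ _⟩

theorem coindicator_of_mem {U : Set X} (hU : IsClopen U) {x : X} (hx : x ∈ U) :
    (coindicator hU).1 x = 0 := if_pos hx

theorem coindicator_of_notMem {U : Set X} (hU : IsClopen U) {x : X} (hx : x ∉ U) :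
    (coindicator hU).1 x = 1 := if_neg hx

theorem coindicator_apply_eq_zero_iff {U : Set X} (hU : IsClopen U) {x : X} :
    (coindicator hU).1 x = 0 ↔ x ∈ U := by
  refine ⟨fun h => ?_, coindicator_of_mem hU⟩
  by_contra hx
  exact (X.isMVChain_stalk x).1 ((coindicator_of_notMem hU hx).symm.trans h)

/-- The pointwise witnesses of `≤` need not form a continuous section; the equation `¬s ⊕ t = 1`
needs no witness and can be checked fiber by fiber. -/
theorem le_of_forall {s t : X.GlobalSections} (h : ∀ x, s.1 x ≤ t.1 x) : s ≤ t :=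
  (le_iff_neg_add s t).2 (Subtype.ext (funext fun x => (le_iff_neg_add _ _).1 (h x)))

/-- A prime ideal contains the section that is `0` on a clopen set and `1` off it, or its
complement. -/
theorem coindicator_mem_or {U : Set X} (hU : IsClopen U) {P : MVIdeal X.GlobalSections}
    (hP : P.IsPrime) : coindicator hU ∈ P ∨ (coindicator hU)ᶜ ∈ P := by
  refine (hP.2 (coindicator hU) (coindicator hU)ᶜ).imp
    (fun h => P.down_mem' h (le_of_forall fun x => ?_))
    (fun h => P.down_mem' h (le_of_forall fun x => ?_))
  · change (coindicator hU).1 x ≤ ominus ((coindicator hU).1 x) ((coindicator hU).1 x)ᶜ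
    by_cases hx : x ∈ U
    · rw [coindicator_of_mem hU hx]
      exact mv_zero_le _
    · rw [coindicator_of_notMem hU hx, mv_neg_one, ominus_zero]
      exact mv_le_refl _
  · change ((coindicator hU).1 x)ᶜ ≤ ominus ((coindicator hU).1 x)ᶜ ((coindicator hU).1 x)
    by_cases hx : x ∈ U
    · rw [coindicator_of_mem hU hx, ominus_zero]
      exact mv_le_refl _
    · rw [coindicator_of_notMem hU hx, mv_neg_one]
      exact mv_zero_le _

/-- Over a compact space with simple fibers, the members of a proper ideal of global sections have
a common zero. -/
theorem exists_forall_mem_eq_zero [CompactSpace X] (hsimple : ∀ x : X, IsSimpleMV (X.stalk x))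
    (I : MVIdeal X.GlobalSections) (hI : (1 : X.GlobalSections) ∉ I) :
    ∃ x : X, ∀ s ∈ I, s.1 x = 0 := by
  by_contra! hne
  -- The property "some member of `I` is `1` on `S`" passes to subsets and to unions (add the two
  -- members) and holds locally, so compactness extends it to the whole space.
  have key : ∃ s ∈ I, ∀ x ∈ (Set.univ : Set X), s.1 x = 1 := by
    refine isCompact_univ.induction_on (p := fun S => ∃ s ∈ I, ∀ x ∈ S, s.1 x = 1)
      ⟨0, I.zero_mem', fun x hx => hx.elim⟩ ?_ ?_ ?_
    · rintro S T hST ⟨s, hs, h⟩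
      exact ⟨s, hs, fun x hx => h x (hST hx)⟩
    · rintro S T ⟨s, hs, h⟩ ⟨t, ht, h'⟩
      refine ⟨s + t, I.add_mem' hs ht, ?_⟩
      intro x hx
      change s.1 x + t.1 x = 1
      rcases hx with hx | hx
      · rw [h x hx, mv_one_add]
      · rw [h' x hx, mv_add_one]
    · intro x _
      obtain ⟨s, hs, hsx⟩ := hne x
      obtain ⟨n, hn⟩ := (hsimple x).exists_nsmul_eq_one hsx
      have hmem : ∀ n : ℕ, n • s ∈ I := by
        intro n
        induction n with
        | zero =>
          rw [zero_nsmul]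
          exact I.zero_mem'
        | succ n ih =>
          rw [succ_nsmul]
          exact I.add_mem' ih hs
      -- The equality `n • s = 1` at `x` spreads to a neighbourhood, since two sections agree on an
      -- open set.
      refine ⟨{y | (n • s).1 y = (1 : X.GlobalSections).1 y},
        mem_nhdsWithin_of_mem_nhds ((X.isOpen_eq_sections (n • s) 1).mem_nhds ?_),
        n • s, hmem n, fun y hy => hy⟩
      exact (map_nsmul (eval x) n s).trans hn
  obtain ⟨s, hs, h⟩ := key
  obtain rfl : s = 1 := Subtype.ext (funext fun x => h x trivial)
  exact hI hs

end GlobalSections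

/-! ### The point map `h` is a homeomorphism -/

open GlobalSections

/-- Clopen sets form a base, so this makes `h` open. Surjectivity is what lets every prime ideal in
the basic open set be written as some `h(x)`. -/
theorem image_counitPoint_of_isClopen (hsurj : Function.Surjective X.counitPoint) {U : Set X}
    (hU : IsClopen U) : X.counitPoint '' U = PrimeSpec.W (coindicator hU) := by
  ext P
  obtain ⟨x, rfl⟩ := hsurj P
  constructor
  · rintro ⟨y, hy, h⟩
    rw [← h]
    exact coindicator_of_mem hU hy
  · intro h
    exact ⟨x, (coindicator_apply_eq_zero_iff hU).1 h, rfl⟩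

/-- A clopen set containing `x` but not `y` has a two-valued section that vanishes at `x` and not at
`y`. -/
theorem counitPoint_injective (hX : IsStoneSpace X) : Function.Injective X.counitPoint := by
  intro x y hxy
  have := hX.hausdorff
  by_contra hne
  obtain ⟨U, hU, hxU, hUy⟩ := hX.clopen_basis.exists_subset_of_mem_open
    (show x ∈ ({y}ᶜ : Set X) from hne) isOpen_compl_singleton
  have hx : coindicator hU ∈ (X.counitPoint x).1 := coindicator_of_mem hU hxU
  rw [hxy] at hx
  exact hUy ((coindicator_apply_eq_zero_iff hU).1 hx) rfl

theorem counitPoint_surjective (hX : IsStoneSpace X)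
    (hsimple : ∀ x : X, IsSimpleMV (X.stalk x)) : Function.Surjective X.counitPoint := by
  rintro ⟨P, hP⟩
  have := hX.compact
  obtain ⟨x, hx⟩ := exists_forall_mem_eq_zero hsimple P hP.1
  refine ⟨x, Subtype.ext ?_⟩
  have hcar : (X.counitPoint x).1.carrier = P.carrier := by
    refine Set.Subset.antisymm (fun s hs => ?_) hx
    -- If `s` vanishes at `x`, it vanishes on a clopen `U` around `x`, hence lies below the section
    -- that is `0` on `U` and `1` off it. Primality puts that section in `P`: its complement is `1`
    -- at `x`, whereas all of `P` vanishes there.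
    obtain ⟨U, hU, hxU, hUs⟩ := hX.clopen_basis.exists_subset_of_mem_open
      (show x ∈ {y : X | s.1 y = (0 : X.GlobalSections).1 y} from hs)
      (X.isOpen_eq_sections s 0)
    rcases coindicator_mem_or hU hP with h | h
    · refine P.down_mem' h (le_of_forall fun y => ?_)
      by_cases hy : y ∈ U
      · rw [show s.1 y = 0 from hUs hy]
        exact mv_zero_le _
      · rw [coindicator_of_notMem hU hy]
        exact mv_le_one _
    · have h0 : ((coindicator hU).1 x)ᶜ = 0 := hx _ h
      rw [coindicator_of_mem hU hxU] at h0
      exact absurd h0 (X.isMVChain_stalk x).1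
  generalize (X.counitPoint x).1 = Q at hcar
  obtain ⟨c, _, _, _⟩ := Q
  obtain ⟨d, _, _, _⟩ := P
  obtain rfl : c = d := hcar
  rfl

/-- The homeomorphism `h` from a Stone space with simple fibers to the prime spectrum of its
global sections. -/
noncomputable def counitHomeomorph (hX : IsStoneSpace X) (hsimple : ∀ x : X, IsSimpleMV (X.stalk x)) :
    X ≃ₜ PrimeSpec X.GlobalSections :=
  (Equiv.ofBijective X.counitPoint
    ⟨counitPoint_injective hX, counitPoint_surjective hX hsimple⟩).toHomeomorphOfContinuousOpen
    X.continuous_counitPoint (by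
      refine hX.clopen_basis.isOpenMap_iff.2 fun U hU => ?_
      change IsOpen (X.counitPoint '' U)
      rw [image_counitPoint_of_isClopen (counitPoint_surjective hX hsimple) hU]
      exact PrimeSpec.isOpen_W _)

/-! ### Inverting the stalk maps and the counit -/

theorem IsGlobal.exists_section (hX : X.IsGlobal) (x : X) (e : X.stalk x) :
    ∃ s : X.GlobalSections, s.1 x = e := by
  obtain ⟨s, hs⟩ := hX ⟨x, e⟩
  exact ⟨s, eq_of_heq (Etale.mk.inj hs).2⟩

/-- This is injectivity of `ε_x`, and makes the choice of a lifting section harmless. `P` is kept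
apart from `h(x)` because a point of the spectrum equals `h(h⁻¹(P))` only propositionally; the
quotients then need no transport. -/
theorem cls_eq_cls_of_apply_eq {P : PrimeSpec X.GlobalSections} {x : X}
    (hx : X.counitPoint x = P) {s t : X.GlobalSections} (h : s.1 x = t.1 x) :
    P.1.cls s = P.1.cls t := by
  subst hx
  rw [MVIdeal.cls_eq_iff, MVIdeal.dist_mem_iff]
  constructor
  · change ominus (s.1 x) (t.1 x) = 0
    rw [h, ominus_self]
  · change ominus (t.1 x) (s.1 x) = 0
    rw [h, ominus_self]

/-- The inverse `E_x → Γ(X, E) / P` of the stalk map of the counit, where `P = h(x)`. -/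
noncomputable def counitInvStalk (hX : X.IsGlobal) {P : PrimeSpec X.GlobalSections} {x : X}
    (hx : X.counitPoint x = P) : MVHom (X.stalk x) P.1.Quot where
  toFun e := P.1.cls (hX.exists_section x e).choose
  map_zero' := cls_eq_cls_of_apply_eq hx (hX.exists_section x 0).choose_spec
  map_add' e e' := by
    refine cls_eq_cls_of_apply_eq (t := (hX.exists_section x e).choose +
      (hX.exists_section x e').choose) hx ((hX.exists_section x (e + e')).choose_spec.trans ?_)
    exact congrArg₂ (· + ·) (hX.exists_section x e).choose_spec.symm
      (hX.exists_section x e').choose_spec.symm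
  map_neg' e := by
    refine cls_eq_cls_of_apply_eq (t := (hX.exists_section x e).chooseᶜ) hx
      ((hX.exists_section x eᶜ).choose_spec.trans ?_)
    exact congrArg (·ᶜ) (hX.exists_section x e).choose_spec.symm

/-- Eliminates the chosen lift: any global section through the value computes the map. Both
composites and the section condition rest on this rule. -/
theorem counitInvStalk_apply (hX : X.IsGlobal) {P : PrimeSpec X.GlobalSections} {x : X}
    (hx : X.counitPoint x = P) (s : X.GlobalSections) :
    counitInvStalk hX hx (s.1 x) = P.1.cls s :=
  cls_eq_cls_of_apply_eq hx (hX.exists_section x (s.1 x)).choose_spec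

/-- A section over an open set agrees near each point with any global section through it. -/
theorem isOpen_eq_isSection {U : Opens X} {s : ∀ x : U, X.stalk x} (hs : X.IsSection U s)
    (t : X.GlobalSections) : IsOpen {x : U | s x = t.1 x} := by
  have h := X.isLocalHomeomorph_base.isLocallyInjective.isOpen_eqLocus hs
    (t.2.comp continuous_subtype_val) (funext fun _ => rfl)
  convert h using 1
  ext x
  simp

/-- The inverse of the counit. -/
noncomputable def counitInv (hX : IsStoneSpace X) (hglobal : X.IsGlobal)
    (hsimple : ∀ x : X, IsSimpleMV (X.stalk x)) : MVSpec X.GlobalSections ⟶ X where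
  map := ⟨(counitHomeomorph hX hsimple).symm, (counitHomeomorph hX hsimple).symm.continuous⟩
  stalkMap P := counitInvStalk hglobal ((counitHomeomorph hX hsimple).apply_symm_apply P)
  isSection V s hs := by
    refine continuous_iff_continuousAt.2 fun P => ?_
    -- Near `h⁻¹(P)` the section `s` agrees with a global section `t` through its value there, so
    -- its transport agrees near `P` with the continuous map `PrimeSpec.hat t`.
    obtain ⟨t, ht⟩ := hglobal.exists_section _
      (s ⟨(counitHomeomorph hX hsimple).symm P.1, P.2⟩)
    refine ((PrimeSpec.continuous_hat t).comp continuous_subtype_val).continuousAt.congr ?_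
    have hc : Continuous fun Q : V.comap (⟨(counitHomeomorph hX hsimple).symm,
        (counitHomeomorph hX hsimple).symm.continuous⟩ : C(PrimeSpec X.GlobalSections, X)) =>
        (⟨(counitHomeomorph hX hsimple).symm Q.1, Q.2⟩ : V) :=
      ((counitHomeomorph hX hsimple).symm.continuous.comp continuous_subtype_val).subtype_mk _
    filter_upwards [hc.continuousAt.preimage_mem_nhds
      ((isOpen_eq_isSection hs t).mem_nhds ht.symm)] with Q hQ
    have h : s ⟨(counitHomeomorph hX hsimple).symm Q.1, Q.2⟩ =
        t.1 ((counitHomeomorph hX hsimple).symm Q.1) := hQ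
    refine congrArg (Etale.mk Q.1) ?_
    refine (counitInvStalk_apply hglobal
      ((counitHomeomorph hX hsimple).apply_symm_apply Q.1) t).symm.trans ?_
    exact congrArg _ h.symm

end MVSpace

theorem theorem5 (X : MVSpace.{u}) (hX : IsStoneSpace X) (hE : T2Space X.total)
    (hglobal : X.IsGlobal) (hsimple : ∀ x : X, IsSimpleMV (X.stalk x)) :
    IsIso X.counit := by
  refine ⟨MVSpace.counitInv hX hglobal hsimple, ?_, ?_⟩
  -- On `X`, global sections reach every value by globality, and `s(x) ↦ [s] ↦ s(x)`.
  · refine MVSpace.Hom.ext_of_sections (fun s : X.GlobalSections => s.1) hglobal.exists_section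
      (MVSpace.counitHomeomorph hX hsimple).symm_apply_apply fun s x => ?_
    exact congrArg (X.counitStalk x) (MVSpace.counitInvStalk_apply hglobal
      ((MVSpace.counitHomeomorph hX hsimple).apply_symm_apply (X.counitPoint x)) s)
  -- On the spectrum, the classes of global sections exhaust each quotient, and `[s] ↦ s(h⁻¹(P)) ↦
  -- [s]`.
  · refine MVSpace.Hom.ext_of_sections (Y := MVSpec X.GlobalSections)
      (fun (s : X.GlobalSections) (P : PrimeSpec X.GlobalSections) => P.1.cls s)
      (fun P e => MVIdeal.cls_surjective _ e)
      (MVSpace.counitHomeomorph hX hsimple).apply_symm_apply fun s P => ?_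
    exact MVSpace.counitInvStalk_apply hglobal
      ((MVSpace.counitHomeomorph hX hsimple).apply_symm_apply P) s
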